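/- Let $n\ge 1$, $1\le p\le\infty$, $0<T\le\infty$. Write $\hat g(\xi)=\int_{\mathbb R^n}e^{-iX\cdot\xi}g(X)\,dX$. Let $\phi,\psi\in\mathcal S(\mathbb R^n)$ be such that $\hat\phi>0$ on $\{2^{-1}<|\xi|<2\}$, $\hat\phi=0$ elsewhere, $\sum_{i\in\mathbb Z}\hat\phi(2^{-i}\xi)=1$ for $\xi\ne0$, and $\hat\psi(\xi)=1-\sum_{i\ge1}\hat\phi(2^{-i}\xi)$; let $\phi_i\in\mathcal S(\mathbb R^n)$ be given by $\hat\phi_i(\xi)=\hat\phi(2^{-i}\xi)$. For a tempered distribution $f\in\mathcal S'(\mathbb R^n)$ put $$\|f\|_{\mathcal B^{-2/p}_p(\mathbb R^n)}=\|\psi*f\|_{L^p(\mathbb R^n)}+\Big(\sum_{i\ge1}\big(2^{-\frac2p i}\|\phi_i*f\|_{L^p(\mathbb R^n)}\big)^p\Big)^{1/p}\quad(p<\infty),$$ $$\|f\|_{\mathcal B^{0}_\infty(\mathbb R^n)}=\max\Big(\|\psi*f\|_{L^\infty(\mathbb R^n)},\ \sup_{i\ge1}\|\phi_i*f\|_{L^\infty(\mathbb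 R^n)}\Big)\quad(p=\infty),$$ and let $\mathcal B^{-2/p}_p(\mathbb R^n)$ be the set of $f\in\mathcal S'(\mathbb R^n)$ for which this norm is finite. For such $f$ let $$u(X,t)=\langle f,\Gamma(X-\cdot,t)\rangle,\qquad \Gamma(X,t)=(4\pi t)^{-n/2}e^{-|X|^2/(4t)},\qquad X\in\mathbb R^n,\ t>0,$$ be its caloric extension, and let $\mathbb R^n_T=\{(X,t):X\in\mathbb R^n,\ 0<t<T\}$. Then there is a finite constant $C$, depending only on $n,p,T$ and on the fixed choice of $\phi$, such that for every $f\in\mathcal B^{-2/p}_p(\mathbb R^n)$ $$\|f\|_{\mathcal B^{-2/p}_p(\mathbb R^n)}\le C\,\|u\|_{L^p(\mathbb R^n_T)},$$ where the right-hand side is read as $+\infty$ if $u\notin L^p(\mathbb R^n_T)$ (in which case nothing is asserted). -/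

import Mathlib

open scoped SchwartzMap FourierTransform ENNReal NNReal
open MeasureTheory

noncomputable section

/-- The heat kernel `Γ(x,t) = (4πt)^{-n/2} exp(-|x|²/(4t))` for `t > 0`, and `0` for `t ≤ 0`. -/
def heatKernel {n : ℕ} (t : ℝ) (x : EuclideanSpace ℝ (Fin n)) : ℝ :=
  if 0 < t then (4 * Real.pi * t) ^ (-(n : ℝ) / 2) * Real.exp (-‖x‖ ^ 2 / (4 * t)) else 0

theorem one_add_pow_mul_exp_le (a : ℝ) (ha : 0 < a) (m : ℕ) :
    ∃ C : ℝ, ∀ r : ℝ, 0 ≤ r → (1 + r) ^ m * Real.exp (-a * r ^ 2) ≤ C := by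
  refine ⟨(m.factorial : ℝ) * Real.exp (1 + 1 / (4 * a)), fun r hr => ?_⟩
  have h1 : (1 + r) ^ m ≤ (m.factorial : ℝ) * Real.exp (1 + r) := by
    have := Real.pow_div_factorial_le_exp (1 + r) (by positivity) m
    rwa [div_le_iff₀' (by positivity)] at this
  have h2 : 1 + r + -a * r ^ 2 ≤ 1 + 1 / (4 * a) := by
    have h3 : 1 / (4 * a) - r + a * r ^ 2 = a * (r - 1 / (2 * a)) ^ 2 := by
      field_simp
      ring
    nlinarith [mul_nonneg ha.le (sq_nonneg (r - 1 / (2 * a)))]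
  calc (1 + r) ^ m * Real.exp (-a * r ^ 2)
      ≤ (m.factorial : ℝ) * Real.exp (1 + r) * Real.exp (-a * r ^ 2) := by gcongr
    _ = (m.factorial : ℝ) * Real.exp (1 + r + -a * r ^ 2) := by rw [mul_assoc, ← Real.exp_add]
    _ ≤ _ := by gcongr

theorem gaussian_smooth {n : ℕ} (a : ℝ) :
    ContDiff ℝ (⊤ : ℕ∞) (fun x : EuclideanSpace ℝ (Fin n) => Real.exp (-a * ‖x‖ ^ 2)) :=
  Real.contDiff_exp.comp (contDiff_const.mul (contDiff_norm_sq ℝ))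

theorem gaussian_decay {n : ℕ} (a : ℝ) (ha : 0 < a) (k m : ℕ) :
    ∃ C : ℝ, ∀ x : EuclideanSpace ℝ (Fin n),
      ‖x‖ ^ k * ‖iteratedFDeriv ℝ m (fun y : EuclideanSpace ℝ (Fin n) =>
        Real.exp (-a * ‖y‖ ^ 2)) x‖ ≤ C := by
  have hq : (fun x : EuclideanSpace ℝ (Fin n) => -a * ‖x‖ ^ 2).HasTemperateGrowth :=
    (Function.HasTemperateGrowth.const (-a)).mul
      (Function.hasTemperateGrowth_norm_sq (EuclideanSpace ℝ (Fin n)))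
  obtain ⟨l, A, hA, hb⟩ := hq.norm_iteratedFDeriv_le_uniform m
  obtain ⟨C, hC⟩ := one_add_pow_mul_exp_le a ha (k + l * m)
  refine ⟨(m.factorial : ℝ) * (1 + A) ^ m * C, fun x => ?_⟩
  have hx : (1 : ℝ) ≤ 1 + ‖x‖ := by linarith [norm_nonneg x]
  have h1 := norm_iteratedFDeriv_comp_le (𝕜 := ℝ) (n := m) (N := (⊤ : ℕ∞))
    (g := Real.exp) (f := fun x : EuclideanSpace ℝ (Fin n) => -a * ‖x‖ ^ 2)
    Real.contDiff_exp hq.1 (by exact_mod_cast le_top) x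
    (C := Real.exp (-a * ‖x‖ ^ 2)) (D := (1 + A) * (1 + ‖x‖) ^ l)
    (fun i _ => by
      rw [norm_iteratedFDeriv_eq_norm_iteratedDeriv, iteratedDeriv_eq_iterate,
        Real.iter_deriv_exp, Real.norm_eq_abs, Real.abs_exp])
    (fun i hi him => by
      have h2 : (1 : ℝ) ≤ (1 + A) * (1 + ‖x‖) ^ l :=
        one_le_mul_of_one_le_of_one_le (by linarith) (one_le_pow₀ hx)
      calc _ ≤ A * (1 + ‖x‖) ^ l := hb i him x
        _ ≤ (1 + A) * (1 + ‖x‖) ^ l := by gcongr; linarith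
        _ ≤ _ := le_self_pow₀ h2 (by omega))
  have h3 : ‖x‖ ^ k ≤ (1 + ‖x‖) ^ k := by gcongr; linarith
  calc _ ≤ (1 + ‖x‖) ^ k * ((m.factorial : ℝ) * Real.exp (-a * ‖x‖ ^ 2) *
        ((1 + A) * (1 + ‖x‖) ^ l) ^ m) := mul_le_mul h3 h1 (norm_nonneg _) (by positivity)
    _ = (m.factorial : ℝ) * (1 + A) ^ m *
        ((1 + ‖x‖) ^ (k + l * m) * Real.exp (-a * ‖x‖ ^ 2)) := by
      rw [mul_pow, ← pow_mul, pow_add]; ring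
    _ ≤ _ := by
      gcongr
      exact hC ‖x‖ (norm_nonneg x)

theorem exists_heatKernel_schwartz {n : ℕ} (t : ℝ) :
    ∃ g : 𝓢(EuclideanSpace ℝ (Fin n), ℂ), ∀ x, g x = (heatKernel t x : ℂ) := by
  by_cases ht : 0 < t
  · let g₀ : 𝓢(EuclideanSpace ℝ (Fin n), ℝ) :=
      { toFun := fun x => Real.exp (-(1 / (4 * t)) * ‖x‖ ^ 2)
        smooth' := gaussian_smooth _
        decay' := gaussian_decay _ (by positivity) }
    refine ⟨(((4 * Real.pi * t) ^ (-(n : ℝ) / 2) : ℝ) • g₀).postcompCLM Complex.ofRealCLM,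
      fun x => ?_⟩
    have h0 : g₀ x = Real.exp (-(1 / (4 * t)) * ‖x‖ ^ 2) := rfl
    have h1 : -(1 / (4 * t)) * ‖x‖ ^ 2 = -‖x‖ ^ 2 / (4 * t) := by ring
    rw [h1] at h0
    simp only [SchwartzMap.postcompCLM_apply, smul_apply, h0, heatKernel, if_pos ht,
      smul_eq_mul, Complex.ofRealCLM_apply]
  · exact ⟨0, fun x => by simp [heatKernel, ht]⟩

/-- The function `x ↦ Γ(x,t)` as a Schwartz function on `ℝⁿ`. -/
def heatKernelSchwartz {n : ℕ} (t : ℝ) : 𝓢(EuclideanSpace ℝ (Fin n), ℂ) where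
  toFun x := (heatKernel t x : ℂ)
  smooth' := by
    obtain ⟨g, hg⟩ := exists_heatKernel_schwartz (n := n) t
    rw [← funext hg]
    exact g.smooth'
  decay' := by
    obtain ⟨g, hg⟩ := exists_heatKernel_schwartz (n := n) t
    rw [← funext hg]
    exact g.decay'

/-- The Schwartz function `y ↦ φ(x - y)`. -/
def reflectTranslate {n : ℕ} (φ : 𝓢(EuclideanSpace ℝ (Fin n), ℂ)) (x : EuclideanSpace ℝ (Fin n)) :
    𝓢(EuclideanSpace ℝ (Fin n), ℂ) :=
  SchwartzMap.compSubConstCLM ℂ x (SchwartzMap.compCLMOfContinuousLinearEquiv ℂ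
    (ContinuousLinearEquiv.neg ℝ (M := EuclideanSpace ℝ (Fin n))) φ)

theorem reflectTranslate_apply {n : ℕ} (φ : 𝓢(EuclideanSpace ℝ (Fin n), ℂ))
    (x y : EuclideanSpace ℝ (Fin n)) : reflectTranslate φ x y = φ (x - y) := by
  simp [reflectTranslate]

/-- The convolution `(φ * f)(x) = ⟨f, φ(x - ·)⟩` of a tempered distribution with a Schwartz
function; it is a (smooth) function on `ℝⁿ`. -/
def distribConv {n : ℕ} (φ : 𝓢(EuclideanSpace ℝ (Fin n), ℂ))
    (f : 𝓢'(EuclideanSpace ℝ (Fin n), ℂ)) (x : EuclideanSpace ℝ (Fin n)) : ℂ :=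
  f (reflectTranslate φ x)

/-- The caloric extension `u(x,t) = ⟨f, Γ(x - ·, t)⟩`. -/
def caloricExtension {n : ℕ} (f : 𝓢'(EuclideanSpace ℝ (Fin n), ℂ))
    (z : EuclideanSpace ℝ (Fin n) × ℝ) : ℂ :=
  distribConv (heatKernelSchwartz z.2) f z.1

/-- The strip `ℝⁿ × (0,T)`, where `0 < T ≤ ∞`. -/
def heatStrip (n : ℕ) (T : ℝ≥0∞) : Set (EuclideanSpace ℝ (Fin n) × ℝ) :=
  {z | 0 < z.2 ∧ ENNReal.ofReal z.2 < T}

/-- The Fourier transform `φ̂(ξ) = ∫ exp(-i x·ξ) φ(x) dx`. Mathlib's `𝓕` has the phase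
`exp(-2πi x·ξ)`, hence the dilation. -/
def fourierHat {n : ℕ} (φ : 𝓢(EuclideanSpace ℝ (Fin n), ℂ)) (ξ : EuclideanSpace ℝ (Fin n)) : ℂ :=
  𝓕 φ ((2 * Real.pi)⁻¹ • ξ)

theorem fourierHat_eq_integral {n : ℕ} (φ : 𝓢(EuclideanSpace ℝ (Fin n), ℂ))
    (ξ : EuclideanSpace ℝ (Fin n)) :
    fourierHat φ ξ = ∫ x, Complex.exp (-(inner ℝ x ξ : ℝ) * Complex.I) * φ x := by
  rw [fourierHat, SchwartzMap.fourier_coe, Real.fourier_eq']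
  congr 1
  ext x
  rw [inner_smul_right, smul_eq_mul]
  congr 3
  have : (Real.pi : ℂ) ≠ 0 := by exact_mod_cast Real.pi_ne_zero
  push_cast
  field_simp

/-- A dyadic resolution of unity on the Fourier side: `φ̂ > 0` on `1/2 < |ξ| < 2`, `φ̂ = 0`
elsewhere, `∑_{i ∈ ℤ} φ̂(2^{-i} ξ) = 1` for `ξ ≠ 0`, and
`ψ̂(ξ) = 1 - ∑_{i ≥ 1} φ̂(2^{-i} ξ)`. -/
structure IsDyadicResolution {n : ℕ} (φ ψ : 𝓢(EuclideanSpace ℝ (Fin n), ℂ)) : Prop where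
  real_pos : ∀ ξ, 1 / 2 < ‖ξ‖ → ‖ξ‖ < 2 → 0 < (fourierHat φ ξ).re ∧ (fourierHat φ ξ).im = 0
  eq_zero : ∀ ξ, ¬(1 / 2 < ‖ξ‖ ∧ ‖ξ‖ < 2) → fourierHat φ ξ = 0
  hasSum_one : ∀ ξ, ξ ≠ 0 → HasSum (fun i : ℤ => fourierHat φ ((2 : ℝ) ^ (-i) • ξ)) 1
  low_hasSum : ∀ ξ,
    HasSum (fun i : ℕ => fourierHat φ ((2 : ℝ) ^ (-((i : ℤ) + 1)) • ξ)) (1 - fourierHat ψ ξ)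

/-- Dilation `x ↦ c x` on `ℝⁿ`, `c ≠ 0`. -/
def dilation {n : ℕ} (c : ℝ) (hc : c ≠ 0) :
    EuclideanSpace ℝ (Fin n) ≃L[ℝ] EuclideanSpace ℝ (Fin n) :=
  ContinuousLinearEquiv.smulLeft (Units.mk0 c hc)

/-- The Schwartz function `φ_i` with Fourier transform `φ̂(2^{-i} ξ)`. -/
def dyadicBlock {n : ℕ} (φ : 𝓢(EuclideanSpace ℝ (Fin n), ℂ)) (i : ℤ) :
    𝓢(EuclideanSpace ℝ (Fin n), ℂ) :=
  𝓕⁻ (SchwartzMap.compCLMOfContinuousLinearEquiv ℂ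
    (dilation ((2 : ℝ) ^ (-i)) (zpow_ne_zero _ two_ne_zero)) (𝓕 φ))

theorem fourierHat_dyadicBlock {n : ℕ} (φ : 𝓢(EuclideanSpace ℝ (Fin n), ℂ)) (i : ℤ)
    (ξ : EuclideanSpace ℝ (Fin n)) :
    fourierHat (dyadicBlock φ i) ξ = fourierHat φ ((2 : ℝ) ^ (-i) • ξ) := by
  have h : dilation (n := n) ((2 : ℝ) ^ (-i)) (zpow_ne_zero _ two_ne_zero) ((2 * Real.pi)⁻¹ • ξ)
      = (2 * Real.pi)⁻¹ • ((2 : ℝ) ^ (-i) • ξ) := by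
    rw [smul_comm]; rfl
  rw [fourierHat, fourierHat, dyadicBlock, FourierTransform.fourier_fourierInv_eq, ← h]
  rfl

/-- The Besov norm `‖f‖_{B^α_{pq}}` of a tempered distribution with respect to the dyadic
resolution `(φ, ψ)`, with values in `[0,∞]`. -/
def besovNorm {n : ℕ} (φ ψ : 𝓢(EuclideanSpace ℝ (Fin n), ℂ)) (α : ℝ) (p q : ℝ≥0∞)
    (f : 𝓢'(EuclideanSpace ℝ (Fin n), ℂ)) : ℝ≥0∞ :=
  if q = ∞ then
    max (eLpNorm (distribConv ψ f) p volume)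
      (⨆ i : ℕ, (2 : ℝ≥0∞) ^ (α * ((i : ℝ) + 1)) *
        eLpNorm (distribConv (dyadicBlock φ ((i : ℤ) + 1)) f) p volume)
  else
    eLpNorm (distribConv ψ f) p volume +
      (∑' i : ℕ, ((2 : ℝ≥0∞) ^ (α * ((i : ℝ) + 1)) *
        eLpNorm (distribConv (dyadicBlock φ ((i : ℤ) + 1)) f) p volume) ^ q.toReal) ^ (1 / q.toReal)

/-- Membership in the Besov space `B^α_{pq}(ℝⁿ)`. -/
def MemBesov {n : ℕ} (φ ψ : 𝓢(EuclideanSpace ℝ (Fin n), ℂ)) (α : ℝ) (p q : ℝ≥0∞)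
    (f : 𝓢'(EuclideanSpace ℝ (Fin n), ℂ)) : Prop :=
  besovNorm φ ψ α p q f < ∞

end

/-! ### Translations of a Schwartz function: seminorm growth and continuity. -/

section Translation

variable {E : Type*} [NormedAddCommGroup E] [NormedSpace ℝ E]

/-! Fix `b > 0` with `b ≤ T`. Since `φ̂` has compact support, `φ̂(ξ) exp(b|ξ|²)` is the transform of
a Schwartz function `k`. Dilating, `φ_i * f = k_i * u(·, 4^{-i} b)`, and `‖k_i‖₁ = ‖k‖₁`, so Young's
inequality gives `‖φ_i * f‖_p ≤ K N(4^{-i} b)` with `N(t) = ‖u(·,t)‖_p` and `K` independent of `i`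
(`exists_eLpNorm_dyadicBlock_le`). The same holds for `ψ` at time `b`.

By the semigroup law and Young's inequality again, `N` is nonincreasing
(`eLpNorm_caloricExtension_antitone`). For `p < ∞`, the `p`-th power of the weight is `4^{-i}`,
which is comparable to the length of `(4^{-i-1} b, 4^{-i} b)`, where `N ≥ N(4^{-i} b)`. These
intervals are disjoint, so the sum is at most a constant times `∫_0^b N^p` (`tsum_dyadic_le`), which
Tonelli bounds by `‖u‖_p^p`. For `p = ∞` the weights are `1`, and monotonicity turns an essential
supremum over the strip into a bound on every slice with `0 < t ≤ b`.

The analytic point underneath is that a tempered distribution passes through a convolution integral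
(`SchwartzMap.apply_eq_integral_compSubConstCLM`). It factors through a finite product of normed
spaces of bounded continuous functions, complete in norm, where continuous functionals commute with
Bochner integrals. -/

theorem SchwartzMap.pow_norm_mul_norm_iteratedFDeriv_sub_le (γ : 𝓢(E, ℂ)) (k m : ℕ) (x y : E) :
    ‖x‖ ^ k * ‖iteratedFDeriv ℝ m γ (x - y)‖ ≤
      2 ^ k * (SchwartzMap.seminorm ℂ k m γ + ‖y‖ ^ k * SchwartzMap.seminorm ℂ 0 m γ) := by
  have h1 : ‖x‖ ^ k ≤ 2 ^ k * (‖x - y‖ ^ k + ‖y‖ ^ k) := by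
    calc ‖x‖ ^ k ≤ (‖x - y‖ + ‖y‖) ^ k := by
          gcongr
          simpa using norm_add_le (x - y) y
      _ ≤ 2 ^ (k - 1) * (‖x - y‖ ^ k + ‖y‖ ^ k) := add_pow_le (norm_nonneg _) (norm_nonneg _) k
      _ ≤ _ := by
          gcongr
          · norm_num
          · omega
  have h2 := SchwartzMap.le_seminorm ℂ k m γ (x - y)
  have h3 := SchwartzMap.norm_iteratedFDeriv_le_seminorm ℂ γ m (x - y)
  calc _ ≤ 2 ^ k * (‖x - y‖ ^ k + ‖y‖ ^ k) * ‖iteratedFDeriv ℝ m γ (x - y)‖ := by gcongr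
    _ = 2 ^ k * (‖x - y‖ ^ k * ‖iteratedFDeriv ℝ m γ (x - y)‖ +
        ‖y‖ ^ k * ‖iteratedFDeriv ℝ m γ (x - y)‖) := by ring
    _ ≤ _ := by gcongr

theorem SchwartzMap.iteratedFDeriv_compSubConstCLM (γ : 𝓢(E, ℂ)) (m : ℕ) (x y : E) :
    iteratedFDeriv ℝ m (SchwartzMap.compSubConstCLM ℂ y γ) x = iteratedFDeriv ℝ m γ (x - y) := by
  have : (SchwartzMap.compSubConstCLM ℂ y γ : E → ℂ) = fun z => γ (z - y) := by
    ext z; simp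
  rw [this, iteratedFDeriv_comp_sub]

theorem SchwartzMap.seminorm_compSubConstCLM_le (γ : 𝓢(E, ℂ)) (k m : ℕ) (y : E) :
    SchwartzMap.seminorm ℂ k m (SchwartzMap.compSubConstCLM ℂ y γ) ≤
      2 ^ k * (SchwartzMap.seminorm ℂ k m γ + ‖y‖ ^ k * SchwartzMap.seminorm ℂ 0 m γ) := by
  refine SchwartzMap.seminorm_le_bound ℂ k m _ (by positivity) fun x => ?_
  rw [SchwartzMap.iteratedFDeriv_compSubConstCLM]
  exact γ.pow_norm_mul_norm_iteratedFDeriv_sub_le k m x y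

theorem SchwartzMap.hasFDerivAt_iteratedFDeriv (γ : 𝓢(E, ℂ)) (m : ℕ) (x : E) :
    HasFDerivAt (iteratedFDeriv ℝ m γ) (fderiv ℝ (iteratedFDeriv ℝ m γ) x) x :=
  (((γ.smooth (m + 1 : ℕ)).differentiable_iteratedFDeriv
    (by exact_mod_cast Nat.lt_succ_self m)) x).hasFDerivAt

/-- Mean value inequality on the unit ball about `y`, applied to `s ↦ ‖x‖ ^ k • D ^ m γ (x - s)`;
one more derivative of `γ` pays for the factor `‖z - y‖`. -/
theorem SchwartzMap.seminorm_compSubConstCLM_sub_le (γ : 𝓢(E, ℂ)) (k m : ℕ) (y z : E)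
    (hyz : ‖z - y‖ ≤ 1) :
    SchwartzMap.seminorm ℂ k m
        (SchwartzMap.compSubConstCLM ℂ z γ - SchwartzMap.compSubConstCLM ℂ y γ) ≤
      2 ^ k * (SchwartzMap.seminorm ℂ k (m + 1) γ +
        (‖y‖ + 1) ^ k * SchwartzMap.seminorm ℂ 0 (m + 1) γ) * ‖z - y‖ := by
  refine SchwartzMap.seminorm_le_bound ℂ k m _ (by positivity) fun x => ?_
  have h0 : iteratedFDeriv ℝ m
      (SchwartzMap.compSubConstCLM ℂ z γ - SchwartzMap.compSubConstCLM ℂ y γ : 𝓢(E, ℂ)) x =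
      iteratedFDeriv ℝ m γ (x - z) - iteratedFDeriv ℝ m γ (x - y) := by
    rw [← SchwartzMap.iteratedFDeriv_compSubConstCLM, ← SchwartzMap.iteratedFDeriv_compSubConstCLM]
    exact iteratedFDeriv_sub_apply ((SchwartzMap.smooth _ m).contDiffAt)
      ((SchwartzMap.smooth _ m).contDiffAt)
  rw [h0]
  have h1 := (convex_closedBall y (1 : ℝ)).norm_image_sub_le_of_norm_hasFDerivWithin_le
    (f := fun s => (‖x‖ ^ k) • iteratedFDeriv ℝ m γ (x - s))
    (f' := fun s => (‖x‖ ^ k) • ((fderiv ℝ (iteratedFDeriv ℝ m γ) (x - s)).comp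
      (-(ContinuousLinearMap.id ℝ E))))
    (C := 2 ^ k * (SchwartzMap.seminorm ℂ k (m + 1) γ +
        (‖y‖ + 1) ^ k * SchwartzMap.seminorm ℂ 0 (m + 1) γ))
    (fun s _ => (((γ.hasFDerivAt_iteratedFDeriv m (x - s)).comp s
      ((hasFDerivAt_id s).const_sub x)).const_smul (‖x‖ ^ k)).hasFDerivWithinAt)
    (fun s hs => by
      have hs' : ‖s‖ ≤ ‖y‖ + 1 := by
        rw [Metric.mem_closedBall, dist_eq_norm] at hs
        have := norm_add_le (s - y) y
        rw [sub_add_cancel] at this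
        linarith
      rw [ContinuousLinearMap.comp_neg, ContinuousLinearMap.comp_id, norm_smul, norm_neg,
        norm_fderiv_iteratedFDeriv, norm_pow, norm_norm]
      refine (γ.pow_norm_mul_norm_iteratedFDeriv_sub_le k (m + 1) x s).trans ?_
      gcongr)
    (Metric.mem_closedBall_self zero_le_one)
    (by rwa [Metric.mem_closedBall, dist_eq_norm] : z ∈ Metric.closedBall y 1)
  rw [← smul_sub, norm_smul, norm_pow, norm_norm] at h1
  exact h1

theorem SchwartzMap.continuous_compSubConstCLM (γ : 𝓢(E, ℂ)) :
    Continuous fun y : E => SchwartzMap.compSubConstCLM ℂ y γ := by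
  refine continuous_iff_continuousAt.2 fun y => ?_
  rw [ContinuousAt, (schwartz_withSeminorms ℂ E ℂ).tendsto_nhds _ _]
  rintro ⟨k, m⟩ ε hε
  set A := 2 ^ k * (SchwartzMap.seminorm ℂ k (m + 1) γ +
        (‖y‖ + 1) ^ k * SchwartzMap.seminorm ℂ 0 (m + 1) γ)
  have hA : 0 ≤ A := by positivity
  -- The radius `1` is what the preceding estimate requires; `A + 1` replaces `A` because `A` may
  -- vanish.
  filter_upwards [Metric.ball_mem_nhds y (show 0 < min 1 (ε / (A + 1)) by positivity)] with z hz
  rw [Metric.mem_ball, dist_eq_norm, lt_min_iff] at hz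
  refine (γ.seminorm_compSubConstCLM_sub_le k m y z hz.1.le).trans_lt ?_
  calc A * ‖z - y‖ ≤ (A + 1) * ‖z - y‖ := by gcongr; linarith
    _ < (A + 1) * (ε / (A + 1)) := by gcongr; exact hz.2
    _ = ε := by field_simp

end Translation

/-! ### Factoring a tempered distribution through bounded continuous functions. -/

section WeightedDerivative

variable {E : Type*} [NormedAddCommGroup E] [NormedSpace ℝ E]

/-- The map `g ↦ (x ↦ ‖x‖ ^ k • D ^ m g x)` from Schwartz functions to bounded continuous
functions. -/
noncomputable def weightedDeriv (k m : ℕ) :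
    𝓢(E, ℂ) →L[ℂ] BoundedContinuousFunction E (E [×m]→L[ℝ] ℂ) :=
  SchwartzMap.mkCLMtoNormedSpace (𝕜 := ℂ) (𝕜' := ℂ) (σ := RingHom.id ℂ) (D := E) (E := ℂ)
    (G := BoundedContinuousFunction E (E [×m]→L[ℝ] ℂ))
    (fun g => BoundedContinuousFunction.ofNormedAddCommGroup
      (fun x => (‖x‖ ^ k) • iteratedFDeriv ℝ m g x)
      ((continuous_norm.pow k).smul ((g.smooth m).continuous_iteratedFDeriv le_rfl))
      (SchwartzMap.seminorm ℂ k m g)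
      (fun x => by
        rw [norm_smul, norm_pow, norm_norm]
        exact SchwartzMap.le_seminorm ℂ k m g x))
    (fun g h => by
      ext1 x
      have : iteratedFDeriv ℝ m (g + h : 𝓢(E, ℂ)) x =
          iteratedFDeriv ℝ m g x + iteratedFDeriv ℝ m h x :=
        iteratedFDeriv_add_apply (g.smooth m).contDiffAt (h.smooth m).contDiffAt
      change (‖x‖ ^ k) • iteratedFDeriv ℝ m (g + h : 𝓢(E, ℂ)) x = _
      rw [this, smul_add]
      rfl)
    (fun c g => by
      ext1 x
      have : iteratedFDeriv ℝ m (c • g : 𝓢(E, ℂ)) x = c • iteratedFDeriv ℝ m g x :=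
        iteratedFDeriv_const_smul_apply (g.smooth m).contDiffAt
      change (‖x‖ ^ k) • iteratedFDeriv ℝ m (c • g : 𝓢(E, ℂ)) x = _
      rw [this, smul_comm]
      rfl)
    ⟨{(k, m)}, 1, zero_le_one, fun g => by
      rw [Finset.sup_singleton, one_mul]
      exact BoundedContinuousFunction.norm_ofNormedAddCommGroup_le _ (apply_nonneg _ _) _⟩

theorem weightedDeriv_apply (k m : ℕ) (g : 𝓢(E, ℂ)) (x : E) :
    weightedDeriv k m g x = (‖x‖ ^ k) • iteratedFDeriv ℝ m g x := rfl

theorem norm_weightedDeriv (k m : ℕ) (g : 𝓢(E, ℂ)) :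
    ‖weightedDeriv k m g‖ = SchwartzMap.seminorm ℂ k m g := by
  refine le_antisymm ?_ (SchwartzMap.seminorm_le_bound ℂ k m g (norm_nonneg (weightedDeriv k m g))
    fun x => ?_)
  · refine (BoundedContinuousFunction.norm_le (apply_nonneg _ _)).2 fun x => ?_
    rw [weightedDeriv_apply, norm_smul, norm_pow, norm_norm]
    exact SchwartzMap.le_seminorm ℂ k m g x
  · refine le_trans (le_of_eq ?_) ((weightedDeriv k m g).norm_coe_le_norm x)
    rw [weightedDeriv_apply, norm_smul, norm_pow, norm_norm]

/-- A linear functional dominated by the norm of a linear map factors through a continuous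
functional. -/
theorem LinearMap.exists_eq_dual_comp {V X : Type*} [AddCommGroup V] [Module ℂ V]
    [NormedAddCommGroup X] [NormedSpace ℂ X] (J : V →ₗ[ℂ] X) (f : V →ₗ[ℂ] ℂ) (C : ℝ)
    (hb : ∀ v, ‖f v‖ ≤ C * ‖J v‖) : ∃ l : StrongDual ℂ X, ∀ v, f v = l (J v) := by
  have hker : J.ker ≤ f.ker := fun g hg => by
    have := hb g
    rw [LinearMap.mem_ker.1 hg, norm_zero, mul_zero] at this
    exact LinearMap.mem_ker.2 (norm_le_zero_iff.1 this)
  let f₁ : J.range →ₗ[ℂ] ℂ := (J.ker.liftQ f hker) ∘ₗ J.quotKerEquivRange.symm.toLinearMap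
  have hf₁ : ∀ g, f₁ ⟨J g, LinearMap.mem_range_self J g⟩ = f g := fun g => by
    have : J.quotKerEquivRange.symm ⟨J g, LinearMap.mem_range_self J g⟩ = J.ker.mkQ g :=
      J.quotKerEquivRange_symm_apply_image g _
    change J.ker.liftQ f hker (J.quotKerEquivRange.symm _) = _
    rw [this]
    simp
  -- Hahn–Banach: the functional induced on the range of `J` is bounded by `C`, hence extends to all
  -- of `X`.
  obtain ⟨l, hl, -⟩ := exists_extension_norm_eq J.range
    (f₁.mkContinuous C (by
      rintro ⟨_, g, rfl⟩
      rw [hf₁]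
      exact hb g))
  exact ⟨l, fun g => by
    rw [← hf₁ g]
    exact (hl ⟨J g, LinearMap.mem_range_self J g⟩).symm⟩

/-- A continuous linear functional on Schwartz space extends to a continuous functional on a
finite product of spaces of bounded continuous functions. -/
theorem exists_eq_dual_weightedDeriv (f : 𝓢(E, ℂ) →L[ℂ] ℂ) :
    ∃ (s : Finset (ℕ × ℕ))
      (l : (∀ i : s, BoundedContinuousFunction E (E [×i.1.2]→L[ℝ] ℂ)) →L[ℂ] ℂ),
      ∀ g, f g = l (fun i => weightedDeriv i.1.1 i.1.2 g) := by
  obtain ⟨s, C, -, hC⟩ := Seminorm.bound_of_continuous (schwartz_withSeminorms ℂ E ℂ)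
    ((normSeminorm ℂ ℂ).comp f.toLinearMap) (continuous_norm.comp f.continuous)
  refine ⟨s, LinearMap.exists_eq_dual_comp
    (X := ∀ i : s, BoundedContinuousFunction E (E [×i.1.2]→L[ℝ] ℂ))
    (LinearMap.pi fun i : s => (weightedDeriv i.1.1 i.1.2).toLinearMap) f.toLinearMap C
    fun g => (hC g).trans ?_⟩
  rw [smul_apply, NNReal.smul_def, smul_eq_mul]
  gcongr
  refine Seminorm.finset_sup_apply_le (norm_nonneg _) fun i hi => ?_
  exact (norm_weightedDeriv i.1 i.2 g).symm.le.trans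
    (norm_le_pi_norm (fun i : s => weightedDeriv i.1.1 i.1.2 g) ⟨i, hi⟩)

end WeightedDerivative

/-! ### Differentiating a convolution under the integral sign. -/

section Convolution

variable {E : Type*} [NormedAddCommGroup E] [NormedSpace ℝ E] [SecondCountableTopology E]
  [MeasurableSpace E] [BorelSpace E] {μ : Measure E}

omit [NormedSpace ℝ E] in
theorem integrable_smul_sub {W : Type*} [NormedAddCommGroup W] [NormedSpace ℂ W] {k : E → ℂ}
    (hk : Integrable k μ) {H : E → W} (hH : Continuous H) {C : ℝ} (hC : ∀ x, ‖H x‖ ≤ C) (x : E) :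
    Integrable (fun y => k y • H (x - y)) μ :=
  hk.smul_bdd (C := C) (hH.comp (continuous_const.sub continuous_id)).aestronglyMeasurable
    (Filter.Eventually.of_forall fun _ => hC _)

theorem fderiv_integral_smul_sub_apply {W : Type*} [NormedAddCommGroup W] [NormedSpace ℝ W]
    [NormedSpace ℂ W] [IsScalarTower ℝ ℂ W] {k : E → ℂ} (hk : Integrable k μ) {H : E → W}
    {H' : E → E →L[ℝ] W} (hH : ∀ x, HasFDerivAt H (H' x) x) (hH' : Continuous H') {C C' : ℝ}
    (hC : ∀ x, ‖H x‖ ≤ C) (hC' : ∀ x, ‖H' x‖ ≤ C') (x v : E) :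
    fderiv ℝ (fun z => ∫ y, k y • H (z - y) ∂μ) x v = ∫ y, k y • H' (x - y) v ∂μ := by
  have hc : Continuous H := continuous_iff_continuousAt.2 fun x => (hH x).continuousAt
  have hi := integrable_smul_sub hk hH' hC' x
  have hd : HasFDerivAt (fun z => ∫ y, k y • H (z - y) ∂μ) (∫ y, k y • H' (x - y) ∂μ) x := ?_
  · rw [hd.fderiv, ContinuousLinearMap.integral_apply hi]
    rfl
  refine hasFDerivAt_integral_of_dominated_of_fderiv_le (s := Set.univ)
    (F' := fun z y => k y • H' (z - y)) (bound := fun y => ‖k y‖ * C') Filter.univ_mem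
    (Filter.Eventually.of_forall fun w => (integrable_smul_sub hk hc hC w).aestronglyMeasurable)
    (integrable_smul_sub hk hc hC x) hi.aestronglyMeasurable
    (Filter.Eventually.of_forall fun y w _ => ?_) (hk.norm.mul_const _)
    (Filter.Eventually.of_forall fun y w _ => ?_)
  · rw [norm_smul]
    gcongr
    exact hC' _
  · exact ((hasFDerivAt_comp_sub y).2 (hH (w - y))).const_smul (k y)

/-- All derivatives fall on `γ`, whose derivatives are bounded, so a multiple of `‖k‖` dominates at
each step of the induction and `k` only needs to be integrable. -/
theorem SchwartzMap.iteratedFDeriv_integral_smul_sub {k : E → ℂ} (hk : Integrable k μ)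
    (γ : 𝓢(E, ℂ)) (m : ℕ) (x : E) :
    iteratedFDeriv ℝ m (fun z => ∫ y, k y • γ (z - y) ∂μ) x =
      ∫ y, k y • iteratedFDeriv ℝ m γ (x - y) ∂μ := by
  have hi : ∀ m x, Integrable (fun y => k y • iteratedFDeriv ℝ m γ (x - y)) μ := fun m x =>
    integrable_smul_sub hk ((γ.smooth m).continuous_iteratedFDeriv le_rfl)
      (SchwartzMap.norm_iteratedFDeriv_le_seminorm ℂ γ m) x
  induction m generalizing x with
  | zero =>
    ext v
    rw [ContinuousMultilinearMap.integral_apply (hi 0 x)]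
    simp
  | succ m ih =>
    have hc : Continuous (fderiv ℝ (iteratedFDeriv ℝ m γ)) := by
      rw [fderiv_iteratedFDeriv]
      exact (LinearIsometryEquiv.continuous _).comp
        ((γ.smooth (m + 1 : ℕ)).continuous_iteratedFDeriv le_rfl)
    have hb : ∀ x, ‖fderiv ℝ (iteratedFDeriv ℝ m γ) x‖ ≤ SchwartzMap.seminorm ℂ 0 (m + 1) γ :=
      fun x => by
        rw [norm_fderiv_iteratedFDeriv]
        exact SchwartzMap.norm_iteratedFDeriv_le_seminorm ℂ γ (m + 1) x
    ext v
    rw [iteratedFDeriv_succ_apply_left, funext ih,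
      fderiv_integral_smul_sub_apply hk (γ.hasFDerivAt_iteratedFDeriv m) hc
        (SchwartzMap.norm_iteratedFDeriv_le_seminorm ℂ γ m) hb x,
      ContinuousMultilinearMap.integral_apply (hi _ x), ContinuousMultilinearMap.integral_apply]
    · rfl
    · exact integrable_smul_sub (C := SchwartzMap.seminorm ℂ 0 (m + 1) γ * ‖v 0‖) hk
        (H := fun x => fderiv ℝ (iteratedFDeriv ℝ m γ) x (v 0)) (hc.clm_apply continuous_const)
        (fun x => ((fderiv ℝ (iteratedFDeriv ℝ m γ) x).le_opNorm (v 0)).trans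
          (mul_le_mul_of_nonneg_right (hb x) (norm_nonneg _))) x

end Convolution

/-! ### Exchanging a tempered distribution with a convolution integral. -/

section Interchange

set_option maxSynthPendingDepth 3

variable {E : Type*} [NormedAddCommGroup E] [NormedSpace ℝ E] [SecondCountableTopology E]
  [MeasurableSpace E] [BorelSpace E] {μ : Measure E}

theorem SchwartzMap.integrable_smul_weightedDeriv_compSubConstCLM [μ.HasTemperateGrowth]
    (k γ : 𝓢(E, ℂ)) (i m : ℕ) :
    Integrable (fun y => k y • weightedDeriv i m (SchwartzMap.compSubConstCLM ℂ y γ)) μ := by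
  have hb : Integrable (fun y => 2 ^ i * (‖k y‖ * SchwartzMap.seminorm ℂ i m γ +
      ‖y‖ ^ i * ‖k y‖ * SchwartzMap.seminorm ℂ 0 m γ)) μ :=
    ((k.integrable.norm.mul_const _).add ((k.integrable_pow_mul μ i).mul_const _)).const_mul _
  refine hb.mono' ?_ (Filter.Eventually.of_forall fun y => ?_)
  -- Bounded continuous functions need not form a separable space; strong measurability comes from
  -- second countability of the domain `E`.
  · have : SecondCountableTopologyEither E (BoundedContinuousFunction E (E [×m]→L[ℝ] ℂ)) :=
      secondCountableTopologyEither_of_left E _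
    exact (k.continuous.smul ((weightedDeriv i m).continuous.comp
      γ.continuous_compSubConstCLM)).aestronglyMeasurable
  · rw [norm_smul, norm_weightedDeriv]
    calc _ ≤ ‖k y‖ * (2 ^ i * (SchwartzMap.seminorm ℂ i m γ +
          ‖y‖ ^ i * SchwartzMap.seminorm ℂ 0 m γ)) := by
          gcongr
          exact γ.seminorm_compSubConstCLM_le i m y
      _ = _ := by ring

/-- Evaluation at a point is a continuous functional, so this Bochner integral of functions can be
computed pointwise. -/
theorem SchwartzMap.integral_smul_weightedDeriv_compSubConstCLM [μ.HasTemperateGrowth]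
    (k γ g : 𝓢(E, ℂ)) (hg : ∀ z, g z = ∫ y, k y • γ (z - y) ∂μ) (i m : ℕ) :
    ∫ y, k y • weightedDeriv i m (SchwartzMap.compSubConstCLM ℂ y γ) ∂μ = weightedDeriv i m g := by
  ext1 x
  have h := (BoundedContinuousFunction.evalCLM ℝ x).integral_comp_comm
    (k.integrable_smul_weightedDeriv_compSubConstCLM (μ := μ) γ i m)
  refine h.symm.trans ?_
  rw [weightedDeriv_apply, show (g : E → ℂ) = fun z => ∫ y, k y • γ (z - y) ∂μ from funext hg,
    γ.iteratedFDeriv_integral_smul_sub k.integrable, ← integral_smul]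
  refine integral_congr_ae (Filter.Eventually.of_forall fun y => ?_)
  simp only [BoundedContinuousFunction.evalCLM_apply, BoundedContinuousFunction.smul_apply,
    weightedDeriv_apply, γ.iteratedFDeriv_compSubConstCLM]
  rw [smul_comm]

/-- A continuous functional on Schwartz space commutes with convolution integrals. -/
theorem SchwartzMap.apply_eq_integral_compSubConstCLM [μ.HasTemperateGrowth]
    (f : 𝓢(E, ℂ) →L[ℂ] ℂ) (k γ g : 𝓢(E, ℂ)) (hg : ∀ z, g z = ∫ y, k y • γ (z - y) ∂μ) :
    f g = ∫ y, k y • f (SchwartzMap.compSubConstCLM ℂ y γ) ∂μ := by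
  obtain ⟨s, l, hl⟩ := exists_eq_dual_weightedDeriv f
  have hi : Integrable (fun y (i : s) =>
      k y • weightedDeriv i.1.1 i.1.2 (SchwartzMap.compSubConstCLM ℂ y γ)) μ :=
    Integrable.of_eval fun i => k.integrable_smul_weightedDeriv_compSubConstCLM γ i.1.1 i.1.2
  rw [hl g]
  have h := l.integral_comp_comm hi
  rw [show (fun i : s => weightedDeriv i.1.1 i.1.2 g) = ∫ y, fun i : s =>
      k y • weightedDeriv i.1.1 i.1.2 (SchwartzMap.compSubConstCLM ℂ y γ) ∂μ from ?_, ← h]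
  · refine integral_congr_ae (Filter.Eventually.of_forall fun y => ?_)
    simp only [hl]
    rw [← map_smul]
    rfl
  · ext1 i
    rw [eval_integral fun i => k.integrable_smul_weightedDeriv_compSubConstCLM γ i.1.1 i.1.2]
    exact (k.integral_smul_weightedDeriv_compSubConstCLM γ g hg _ _).symm

end Interchange

/-! ### Convolution with a distribution, factored on the Fourier side. -/

section DistribConv

variable {n : ℕ}

theorem continuous_distribConv (γ : 𝓢(EuclideanSpace ℝ (Fin n), ℂ))
    (f : 𝓢'(EuclideanSpace ℝ (Fin n), ℂ)) : Continuous (distribConv γ f) :=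
  f.continuous.comp (SchwartzMap.continuous_compSubConstCLM _)

theorem compSubConstCLM_reflectTranslate (γ : 𝓢(EuclideanSpace ℝ (Fin n), ℂ))
    (x y : EuclideanSpace ℝ (Fin n)) :
    SchwartzMap.compSubConstCLM ℂ y (reflectTranslate γ x) = reflectTranslate γ (x + y) := by
  ext z
  rw [SchwartzMap.compSubConstCLM_apply, reflectTranslate_apply, reflectTranslate_apply]
  congr 1
  abel

/-- The Fourier hypothesis says `g = k * γ`, and the interchange lemma then moves `f` inside the
integral. Translating `γ(x - ·)` by `y` gives `γ(x + y - ·)`, so `k` enters reflected and `y` is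
replaced by `-y`. -/
theorem distribConv_eq_integral (k γ g : 𝓢(EuclideanSpace ℝ (Fin n), ℂ))
    (h : ∀ ξ, 𝓕 g ξ = 𝓕 k ξ * 𝓕 γ ξ) (f : 𝓢'(EuclideanSpace ℝ (Fin n), ℂ))
    (x : EuclideanSpace ℝ (Fin n)) :
    distribConv g f x = ∫ y, k y * distribConv γ f (x - y) := by
  have hc : g = SchwartzMap.convolution (ContinuousLinearMap.mul ℂ ℂ) k γ := by
    rw [← FourierTransform.fourierInv_fourier_eq (F := 𝓢(EuclideanSpace ℝ (Fin n), ℂ)) g,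
      ← FourierTransform.fourierInv_fourier_eq (F := 𝓢(EuclideanSpace ℝ (Fin n), ℂ))
        (SchwartzMap.convolution _ k γ), SchwartzMap.fourier_convolution]
    congr 1
    ext ξ
    simp [h]
  have hg : ∀ z, g z = ∫ y, k y * γ (z - y) := fun z => by
    conv_lhs => rw [hc, SchwartzMap.convolution_apply]
    rfl
  rw [← integral_neg_eq_self]
  have h2 := SchwartzMap.apply_eq_integral_compSubConstCLM (μ := volume) f (reflectTranslate k 0)
    (reflectTranslate γ x) (reflectTranslate g x) fun z => by
      rw [reflectTranslate_apply, hg, ← integral_neg_eq_self]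
      refine integral_congr_ae (Filter.Eventually.of_forall fun y => ?_)
      simp only [reflectTranslate_apply, zero_sub, smul_eq_mul]
      congr 2
      abel
  refine h2.trans (integral_congr_ae (Filter.Eventually.of_forall fun y => ?_))
  simp only [reflectTranslate_apply, zero_sub, smul_eq_mul, compSubConstCLM_reflectTranslate,
    sub_neg_eq_add]
  rfl

end DistribConv

/-! ### Young's inequality. -/

section Young

variable {E : Type*} [NormedAddCommGroup E] [MeasurableSpace E] [BorelSpace E]
  [SecondCountableTopology E] {μ : Measure E} [SFinite μ]
  [μ.IsAddLeftInvariant] [μ.IsNegInvariant]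

/-- Young's inequality `‖k ⋆ v‖_p ≤ ‖k‖_1 ‖v‖_p` for continuous functions. -/
theorem eLpNorm_integral_mul_sub_le {p : ℝ≥0∞} (hp : 1 ≤ p) {k v : E → ℂ} (hkc : Continuous k)
    (hv : Continuous v) :
    eLpNorm (fun x => ∫ y, k y * v (x - y) ∂μ) p μ ≤ eLpNorm k 1 μ * eLpNorm v p μ := by
  have hm : Measurable fun y => ‖k y‖ₑ := hkc.enorm.measurable
  -- Under the finite measure `‖k‖ μ`, Hölder bounds the `L¹` norm of `v(x - ·)` by its `L^p` norm
  -- times a power of the total mass; Tonelli then integrates in `x`.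
  set ν := μ.withDensity fun y => ‖k y‖ₑ with hν
  have hνu : ν Set.univ = eLpNorm k 1 μ := by
    rw [hν, withDensity_apply _ MeasurableSet.univ, Measure.restrict_univ,
      eLpNorm_one_eq_lintegral_enorm]
  have hν1 : ∀ F : E → ℝ≥0∞, Measurable F → ∫⁻ y, F y ∂ν = ∫⁻ y, ‖k y‖ₑ * F y ∂μ := fun F hF =>
    lintegral_withDensity_eq_lintegral_mul _ hm hF
  have hvm : ∀ x, Continuous fun y => v (x - y) := fun x =>
    hv.comp (continuous_const.sub continuous_id)
  have hpt : ∀ x, ‖∫ y, k y * v (x - y) ∂μ‖ₑ ≤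
      eLpNorm (fun y => v (x - y)) p ν * eLpNorm k 1 μ ^ (1 - 1 / p.toReal) := fun x => by
    refine (enorm_integral_le_lintegral_enorm _).trans ?_
    simp_rw [enorm_mul]
    rw [← hν1 _ (hvm x).enorm.measurable, ← eLpNorm_one_eq_lintegral_enorm, ← hνu]
    simpa using eLpNorm_le_eLpNorm_mul_rpow_measure_univ hp (hvm x).aestronglyMeasurable (μ := ν)
  rcases eq_or_ne p ∞ with rfl | hp'
  · refine eLpNormEssSup_le_of_ae_enorm_bound (Filter.Eventually.of_forall fun x => ?_)
    refine (hpt x).trans ?_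
    rw [mul_comm]
    -- Since `∞.toReal = 0` and `1 / 0 = 0`, the exponent `1 - 1 / p.toReal` takes the correct value
    -- `1`.
    simp only [ENNReal.toReal_top, div_zero, sub_zero, ENNReal.rpow_one]
    gcongr
    refine (eLpNormEssSup_mono_measure _ (withDensity_absolutelyContinuous μ _)).trans (le_of_eq ?_)
    have := eLpNorm_comp_measurePreserving (p := ∞) (ν := μ) (g := v) hv.aestronglyMeasurable
      (Measure.measurePreserving_sub_left μ x)
    rw [eLpNorm_exponent_top, eLpNorm_exponent_top] at this
    exact this
  · have hp0 : p ≠ 0 := (zero_lt_one.trans_le hp).ne'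
    have hpr : 1 ≤ p.toReal := by simpa using (ENNReal.toReal_le_toReal ENNReal.one_ne_top hp').2 hp
    have hr0 : 0 < p.toReal := zero_lt_one.trans_le hpr
    rw [← ENNReal.rpow_le_rpow_iff hr0, ENNReal.mul_rpow_of_nonneg _ _ hr0.le]
    have hpow : ∀ (ρ : Measure E) (w : E → ℂ),
        eLpNorm w p ρ ^ p.toReal = ∫⁻ x, ‖w x‖ₑ ^ p.toReal ∂ρ := fun ρ w => by
      rw [eLpNorm_eq_lintegral_rpow_enorm_toReal hp0 hp', ← ENNReal.rpow_mul,
        one_div_mul_cancel hr0.ne', ENNReal.rpow_one]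
    have hmeas : Measurable fun z : E × E => ‖k z.2‖ₑ * ‖v (z.1 - z.2)‖ₑ ^ p.toReal :=
      (hkc.comp continuous_snd).enorm.measurable.mul
        ((hv.comp (continuous_fst.sub continuous_snd)).enorm.measurable.pow_const _)
    calc eLpNorm (fun x => ∫ y, k y * v (x - y) ∂μ) p μ ^ p.toReal
        = ∫⁻ x, ‖∫ y, k y * v (x - y) ∂μ‖ₑ ^ p.toReal ∂μ := hpow _ _
      _ ≤ ∫⁻ x, (∫⁻ y, ‖k y‖ₑ * ‖v (x - y)‖ₑ ^ p.toReal ∂μ) *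
            eLpNorm k 1 μ ^ (p.toReal - 1) ∂μ := by
          refine lintegral_mono fun x => ?_
          refine (ENNReal.rpow_le_rpow (hpt x) hr0.le).trans (le_of_eq ?_)
          rw [ENNReal.mul_rpow_of_nonneg _ _ hr0.le, hpow,
            hν1 _ ((hvm x).enorm.measurable.pow_const _), ← ENNReal.rpow_mul]
          congr 2
          field_simp
      _ = (∫⁻ y, ∫⁻ x, ‖k y‖ₑ * ‖v (x - y)‖ₑ ^ p.toReal ∂μ ∂μ) *
            eLpNorm k 1 μ ^ (p.toReal - 1) := by
          rw [lintegral_mul_const _ hmeas.lintegral_prod_right', lintegral_lintegral_swap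
            hmeas.aemeasurable]
      _ = (∫⁻ y, ‖k y‖ₑ * eLpNorm v p μ ^ p.toReal ∂μ) * eLpNorm k 1 μ ^ (p.toReal - 1) := by
          congr 2
          ext y
          have hc : Continuous fun x => v (x - y) := hv.comp (continuous_id.sub continuous_const)
          rw [lintegral_const_mul _ (hc.enorm.measurable.pow_const _), hpow,
            lintegral_sub_right_eq_self (fun x => ‖v x‖ₑ ^ p.toReal) y]
      _ = eLpNorm k 1 μ ^ p.toReal * eLpNorm v p μ ^ p.toReal := by
          rw [lintegral_mul_const _ hm, ← eLpNorm_one_eq_lintegral_enorm, mul_right_comm]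
          congr 1
          nth_rewrite 1 [← ENNReal.rpow_one (eLpNorm k 1 μ)]
          rw [← ENNReal.rpow_add_of_nonneg _ _ zero_le_one (by linarith), add_sub_cancel]

end Young

/-! ### Heat semigroup: Fourier transform, unit mass, monotonicity, measurability. -/

section HeatKernel

variable {n : ℕ}

theorem heatKernelSchwartz_apply (t : ℝ) (x : EuclideanSpace ℝ (Fin n)) :
    heatKernelSchwartz t x = (heatKernel t x : ℂ) := rfl

theorem heatKernel_nonneg (t : ℝ) (x : EuclideanSpace ℝ (Fin n)) : 0 ≤ heatKernel t x := by
  unfold heatKernel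
  split_ifs <;> positivity

theorem measurable_heatKernel :
    Measurable fun z : ℝ × EuclideanSpace ℝ (Fin n) => heatKernel z.1 z.2 := by
  unfold heatKernel
  refine Measurable.ite (measurableSet_lt measurable_const measurable_fst) ?_ measurable_const
  fun_prop

theorem fourier_heatKernelSchwartz {t : ℝ} (ht : 0 < t) (ξ : EuclideanSpace ℝ (Fin n)) :
    𝓕 (heatKernelSchwartz (n := n) t) ξ = Complex.exp (-(4 * Real.pi ^ 2 * t * ‖ξ‖ ^ 2 : ℝ)) := by
  have hf : (heatKernelSchwartz (n := n) t : EuclideanSpace ℝ (Fin n) → ℂ) = fun x =>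
      (((4 * Real.pi * t) ^ (-(n : ℝ) / 2) : ℝ) : ℂ) •
        Complex.exp (-((1 / (4 * t) : ℝ) : ℂ) * ‖x‖ ^ 2) := by
    ext x
    rw [heatKernelSchwartz_apply, heatKernel, if_pos ht, smul_eq_mul]
    push_cast
    congr 2
    field_simp
  have hb : 0 < (((1 / (4 * t) : ℝ) : ℂ)).re := by
    rw [Complex.ofReal_re]
    positivity
  have hg := fourier_gaussian_innerProductSpace hb ξ
  have hc : 𝓕 (heatKernelSchwartz (n := n) t) ξ =
      (((4 * Real.pi * t) ^ (-(n : ℝ) / 2) : ℝ) : ℂ) * 𝓕 (fun x : EuclideanSpace ℝ (Fin n) =>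
        Complex.exp (-((1 / (4 * t) : ℝ) : ℂ) * ‖x‖ ^ 2)) ξ := by
    rw [SchwartzMap.fourier_coe, hf, Real.fourier_eq', Real.fourier_eq', ← integral_const_mul]
    refine integral_congr_ae (Filter.Eventually.of_forall fun x => ?_)
    simp only [smul_eq_mul]
    ring
  rw [hc, hg, finrank_euclideanSpace_fin, ← mul_assoc]
  have hpos : 0 < 4 * Real.pi * t := by positivity
  have h1 : ((Real.pi : ℂ) / ((1 / (4 * t) : ℝ) : ℂ)) ^ ((n : ℂ) / 2) =
      (((4 * Real.pi * t) ^ ((n : ℝ) / 2) : ℝ) : ℂ) := by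
    rw [Complex.ofReal_cpow hpos.le]
    push_cast
    congr 1
    field_simp
  rw [h1, ← Complex.ofReal_mul, ← Real.rpow_add hpos, neg_div, neg_add_cancel, Real.rpow_zero,
    Complex.ofReal_one, one_mul]
  congr 1
  have : (t : ℂ) ≠ 0 := by exact_mod_cast ht.ne'
  push_cast
  field_simp

theorem eLpNorm_heatKernelSchwartz {t : ℝ} (ht : 0 < t) :
    eLpNorm (heatKernelSchwartz (n := n) t) 1 volume = 1 := by
  have h : ∫ x, heatKernelSchwartz (n := n) t x = 1 := by
    have := fourier_heatKernelSchwartz (n := n) ht 0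
    rw [SchwartzMap.fourier_coe, Real.fourier_eq'] at this
    simpa using this
  have h' : ∫ x : EuclideanSpace ℝ (Fin n), heatKernel t x = 1 := by
    simp_rw [heatKernelSchwartz_apply] at h
    rw [integral_complex_ofReal] at h
    exact_mod_cast h
  rw [eLpNorm_one_eq_lintegral_enorm, ← ofReal_integral_norm_eq_lintegral_enorm
    (heatKernelSchwartz t).integrable]
  simp_rw [heatKernelSchwartz_apply, Complex.norm_real, Real.norm_of_nonneg (heatKernel_nonneg _ _)]
  rw [h', ENNReal.ofReal_one]

theorem caloricExtension_eq_integral (f : 𝓢'(EuclideanSpace ℝ (Fin n), ℂ)) {s t : ℝ} (hs : 0 < s)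
    (hst : s < t) (x : EuclideanSpace ℝ (Fin n)) :
    caloricExtension f (x, t) =
      ∫ y, heatKernelSchwartz (t - s) y * caloricExtension f (x - y, s) := by
  change distribConv (heatKernelSchwartz t) f x =
    ∫ y, heatKernelSchwartz (t - s) y * distribConv (heatKernelSchwartz s) f (x - y)
  refine distribConv_eq_integral _ _ _ (fun ξ => ?_) f x
  rw [fourier_heatKernelSchwartz (hs.trans hst), fourier_heatKernelSchwartz hs,
    fourier_heatKernelSchwartz (sub_pos.2 hst), ← Complex.exp_add]
  congr 1
  push_cast
  ring

theorem continuous_caloricExtension (f : 𝓢'(EuclideanSpace ℝ (Fin n), ℂ)) (t : ℝ) :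
    Continuous fun x => caloricExtension f (x, t) :=
  continuous_distribConv (heatKernelSchwartz t) f

/-- Passing from time `s` to time `t` is convolution with a heat kernel of mass one, a contraction
on `L^p`. -/
theorem eLpNorm_caloricExtension_antitone {p : ℝ≥0∞} (hp : 1 ≤ p)
    (f : 𝓢'(EuclideanSpace ℝ (Fin n), ℂ)) {s t : ℝ} (hs : 0 < s) (hst : s ≤ t) :
    eLpNorm (fun x => caloricExtension f (x, t)) p volume ≤
      eLpNorm (fun x => caloricExtension f (x, s)) p volume := by
  rcases hst.eq_or_lt with rfl | hst
  · rfl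
  rw [funext (caloricExtension_eq_integral f hs hst)]
  have := eLpNorm_integral_mul_sub_le (μ := volume) hp
    (heatKernelSchwartz (n := n) (t - s)).continuous
    (continuous_caloricExtension f s)
  rwa [eLpNorm_heatKernelSchwartz (sub_pos.2 hst), one_mul] at this

/-- For times beyond `s = 1/(k+1)`, the semigroup law writes `u` as a parametric integral of a
jointly measurable function; these regions exhaust `t > 0`. Joint measurability is what Tonelli
needs. -/
theorem aestronglyMeasurable_caloricExtension (f : 𝓢'(EuclideanSpace ℝ (Fin n), ℂ)) :
    AEStronglyMeasurable (caloricExtension f) (volume.restrict {z | 0 < z.2}) := by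
  have hU : {z : EuclideanSpace ℝ (Fin n) × ℝ | 0 < z.2} =
      ⋃ k : ℕ, {z | 1 / ((k : ℝ) + 1) < z.2} := by
    ext z
    simp only [Set.mem_ofPred_eq, Set.mem_iUnion]
    exact ⟨fun h => exists_nat_one_div_lt h, fun ⟨k, hk⟩ => (by positivity : (0:ℝ) < _).trans hk⟩
  rw [hU, aestronglyMeasurable_iUnion_iff]
  intro k
  have hs : 0 < 1 / ((k : ℝ) + 1) := by positivity
  set s := 1 / ((k : ℝ) + 1)
  have hm : Measurable fun z : (EuclideanSpace ℝ (Fin n) × ℝ) × EuclideanSpace ℝ (Fin n) =>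
      heatKernelSchwartz (z.1.2 - s) z.2 * caloricExtension f (z.1.1 - z.2, s) := by
    refine Measurable.mul ?_ ?_
    · exact Complex.measurable_ofReal.comp (measurable_heatKernel.comp
        (((measurable_snd.comp measurable_fst).sub_const s).prodMk measurable_snd))
    · exact (continuous_caloricExtension f s).measurable.comp
        ((measurable_fst.comp measurable_fst).sub measurable_snd)
  refine (hm.stronglyMeasurable.integral_prod_right'
    (ν := volume)).aestronglyMeasurable.congr ?_
  refine (ae_restrict_iff' (measurableSet_lt measurable_const measurable_snd)).2
    (Filter.Eventually.of_forall fun z hz => ?_)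
  exact (caloricExtension_eq_integral f hs hz z.1).symm

end HeatKernel

/-! ### Dyadic blocks and inversion of the heat flow on compact frequency support. -/

section DyadicBlock

variable {n : ℕ}

theorem fourier_dyadicBlock (φ : 𝓢(EuclideanSpace ℝ (Fin n), ℂ)) (i : ℤ)
    (ξ : EuclideanSpace ℝ (Fin n)) : 𝓕 (dyadicBlock φ i) ξ = 𝓕 φ ((2 : ℝ) ^ (-i) • ξ) := by
  rw [dyadicBlock, FourierTransform.fourier_fourierInv_eq]
  rfl

theorem dyadicBlock_zero (φ : 𝓢(EuclideanSpace ℝ (Fin n), ℂ)) : dyadicBlock φ 0 = φ := by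
  have h : 𝓕 (dyadicBlock φ 0) = 𝓕 φ := by
    ext ξ
    rw [fourier_dyadicBlock]
    simp
  have h' := congrArg (fun g : 𝓢(EuclideanSpace ℝ (Fin n), ℂ) => 𝓕⁻ g) h
  simpa using h'

theorem dyadicBlock_apply (φ : 𝓢(EuclideanSpace ℝ (Fin n), ℂ)) (i : ℤ)
    (x : EuclideanSpace ℝ (Fin n)) :
    dyadicBlock φ i x = |(((2 : ℝ) ^ (-i)) ^ n)⁻¹| • φ (((2 : ℝ) ^ (-i))⁻¹ • x) := by
  have h := Measure.integral_comp_smul (volume : Measure (EuclideanSpace ℝ (Fin n)))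
    (fun w => Complex.exp (((2 * Real.pi * inner ℝ w (((2 : ℝ) ^ (-i))⁻¹ • x) : ℝ) : ℂ) *
      Complex.I) • 𝓕 φ w) ((2 : ℝ) ^ (-i))
  rw [finrank_euclideanSpace_fin, ← Real.fourierInv_eq', ← SchwartzMap.fourierInv_coe,
    FourierTransform.fourierInv_fourier_eq] at h
  rw [← h, dyadicBlock, SchwartzMap.fourierInv_coe, Real.fourierInv_eq']
  refine integral_congr_ae (Filter.Eventually.of_forall fun v => ?_)
  have h2 : (2 : ℝ) ^ (-i) ≠ 0 := zpow_ne_zero _ two_ne_zero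
  simp only [inner_smul_left, inner_smul_right, RCLike.conj_to_real]
  rw [inv_mul_cancel_left₀ h2]
  rfl

/-- Scale invariance of the `L¹` norm; it makes the constant for Littlewood–Paley pieces independent
of `i`. -/
theorem eLpNorm_dyadicBlock (φ : 𝓢(EuclideanSpace ℝ (Fin n), ℂ)) (i : ℤ) :
    eLpNorm (dyadicBlock φ i) 1 volume = eLpNorm φ 1 volume := by
  rw [eLpNorm_one_eq_lintegral_enorm, eLpNorm_one_eq_lintegral_enorm,
    ← ofReal_integral_norm_eq_lintegral_enorm (dyadicBlock φ i).integrable,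
    ← ofReal_integral_norm_eq_lintegral_enorm φ.integrable]
  congr 1
  simp_rw [dyadicBlock_apply, norm_smul]
  rw [integral_const_mul, Measure.integral_comp_smul volume (fun x => ‖φ x‖),
    finrank_euclideanSpace_fin, smul_eq_mul, ← mul_assoc]
  have h2 : (2 : ℝ) ^ (-i) ≠ 0 := zpow_ne_zero _ two_ne_zero
  have : ‖|(((2 : ℝ) ^ (-i)) ^ n)⁻¹|‖ * |(((2 : ℝ) ^ (-i))⁻¹ ^ n)⁻¹| = 1 := by
    rw [Real.norm_eq_abs, abs_abs, ← abs_mul, inv_pow, inv_inv, inv_mul_cancel₀ (pow_ne_zero _ h2),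
      abs_one]
  rw [this, one_mul]

/-- The backward heat multiplier grows too fast in general, but times a compactly supported smooth
function it remains Schwartz. -/
theorem exists_fourier_eq_mul_exp {g : 𝓢(EuclideanSpace ℝ (Fin n), ℂ)} (b : ℝ)
    (hg : HasCompactSupport fun ξ => 𝓕 g ξ) :
    ∃ k : 𝓢(EuclideanSpace ℝ (Fin n), ℂ), ∀ ξ,
      𝓕 k ξ = 𝓕 g ξ * Complex.exp ((4 * Real.pi ^ 2 * b * ‖ξ‖ ^ 2 : ℝ)) := by
  have hs : ContDiff ℝ (⊤ : ℕ∞) fun ξ : EuclideanSpace ℝ (Fin n) => 𝓕 g ξ *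
      Complex.exp ((4 * Real.pi ^ 2 * b * ‖ξ‖ ^ 2 : ℝ)) :=
    ((𝓕 g).smooth ⊤).mul (Complex.contDiff_exp.comp
      (Complex.ofRealCLM.contDiff.comp (contDiff_const.mul (contDiff_norm_sq ℝ))))
  have hc : HasCompactSupport fun ξ : EuclideanSpace ℝ (Fin n) => 𝓕 g ξ *
      Complex.exp ((4 * Real.pi ^ 2 * b * ‖ξ‖ ^ 2 : ℝ)) := hg.mul_right
  refine ⟨𝓕⁻ (hc.toSchwartzMap hs), fun ξ => ?_⟩
  rw [FourierTransform.fourier_fourierInv_eq]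
  rfl

/-- A Littlewood-Paley piece of `f` is controlled by the caloric extension at a comparable time. -/
theorem exists_eLpNorm_dyadicBlock_le {p : ℝ≥0∞} (hp : 1 ≤ p)
    {g : 𝓢(EuclideanSpace ℝ (Fin n), ℂ)} (hg : HasCompactSupport fun ξ => 𝓕 g ξ) {b : ℝ} (hb : 0 < b) :
    ∃ K : ℝ≥0, ∀ (f : 𝓢'(EuclideanSpace ℝ (Fin n), ℂ)) (i : ℤ),
      eLpNorm (distribConv (dyadicBlock g i) f) p volume ≤
        K * eLpNorm (fun x => caloricExtension f (x, ((2 : ℝ) ^ (-i)) ^ 2 * b)) p volume := by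
  obtain ⟨k, hk⟩ := exists_fourier_eq_mul_exp b hg
  refine ⟨(eLpNorm k 1 volume).toNNReal, fun f i => ?_⟩
  rw [ENNReal.coe_toNNReal (k.eLpNorm_lt_top 1 volume).ne, ← eLpNorm_dyadicBlock k i]
  have h2 : 0 < (2 : ℝ) ^ (-i) := by positivity
  rw [funext (distribConv_eq_integral (dyadicBlock k i)
    (heatKernelSchwartz (((2 : ℝ) ^ (-i)) ^ 2 * b)) (dyadicBlock g i) (fun ξ => ?_) f)]
  · exact eLpNorm_integral_mul_sub_le hp (dyadicBlock k i).continuous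
      (continuous_caloricExtension f _)
  -- Dilating by `2^{-i}` turns `b‖ξ‖²` into `(2^{-i})² b ‖ξ‖²`, so the heat factor at time
  -- `(2^{-i})² b` cancels it exactly.
  · rw [fourier_dyadicBlock, fourier_dyadicBlock, hk, fourier_heatKernelSchwartz (by positivity),
      mul_assoc, ← Complex.exp_add, norm_smul, Real.norm_of_nonneg h2.le]
    convert (mul_one _).symm
    rw [← Complex.exp_zero]
    congr 1
    push_cast
    ring

end DyadicBlock

/-! ### Compact frequency support of the resolution. -/

section Support

variable {n : ℕ} {φ ψ : 𝓢(EuclideanSpace ℝ (Fin n), ℂ)}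

theorem hasCompactSupport_fourier_of_fourierHat {g : 𝓢(EuclideanSpace ℝ (Fin n), ℂ)}
    (h : ∀ ξ, 2 ≤ ‖ξ‖ → fourierHat g ξ = 0) : HasCompactSupport fun ξ => 𝓕 g ξ := by
  -- Because `𝓕 g ξ = fourierHat g (2πξ)`, the support already lies in radius `1/π`; radius `2` is a
  -- convenient larger choice.
  refine HasCompactSupport.intro (isCompact_closedBall 0 2) fun ξ hξ => ?_
  have h3 : (2 * Real.pi)⁻¹ • (2 * Real.pi) • ξ = ξ := by
    rw [smul_smul, inv_mul_cancel₀ (by positivity), one_smul]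
  rw [← h3]
  refine h ((2 * Real.pi) • ξ) ?_
  rw [mem_closedBall_zero_iff, not_le] at hξ
  rw [norm_smul, Real.norm_of_nonneg (by positivity)]
  nlinarith [Real.two_le_pi]

theorem IsDyadicResolution.hasCompactSupport_fourier (h : IsDyadicResolution φ ψ) :
    HasCompactSupport fun ξ => 𝓕 φ ξ :=
  hasCompactSupport_fourier_of_fourierHat fun ξ hξ => h.eq_zero ξ fun h' => h'.2.not_ge hξ

/-- For `‖ξ‖ ≥ 2` the terms with `i ≤ 0` vanish, so the sum over `i ≥ 1` is already the full sum
`1`, leaving `ψ̂(ξ) = 0`. -/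
theorem IsDyadicResolution.hasCompactSupport_fourier_low (h : IsDyadicResolution φ ψ) :
    HasCompactSupport fun ξ => 𝓕 ψ ξ := by
  refine hasCompactSupport_fourier_of_fourierHat fun ξ hξ => ?_
  have hξ0 : ξ ≠ 0 := by
    rintro rfl
    norm_num at hξ
  have hinj : Function.Injective fun i : ℕ => (i : ℤ) + 1 := fun a b hab => by
    simpa using hab
  have h1 := (hinj.hasSum_iff (f := fun i : ℤ => fourierHat φ ((2 : ℝ) ^ (-i) • ξ))
    (a := 1) fun i hi => h.eq_zero _ fun h' => ?_).2 (h.hasSum_one ξ hξ0)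
  · have := h1.unique (h.low_hasSum ξ)
    linear_combination this
  · have hi0 : i ≤ 0 := by
      by_contra hi'
      exact hi ⟨(i - 1).toNat, by simp only; omega⟩
    have h2 : (1 : ℝ) ≤ 2 ^ (-i) := one_le_zpow₀ one_le_two (by omega)
    have h3 := h'.2
    rw [norm_smul, Real.norm_of_nonneg (by positivity)] at h3
    nlinarith

end Support

/-! ### From the norm on the strip to norms of time slices. -/

section Slices

variable {n : ℕ} {p T : ℝ≥0∞} {b : ℝ}

theorem prod_restrict_Ioo_le_restrict_heatStrip (hbT : ENNReal.ofReal b ≤ T) :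
    (volume : Measure (EuclideanSpace ℝ (Fin n))).prod (volume.restrict (Set.Ioo 0 b)) ≤
      volume.restrict (heatStrip n T) := by
  rw [← Measure.restrict_univ (μ := (volume : Measure (EuclideanSpace ℝ (Fin n)))),
    Measure.prod_restrict]
  refine Measure.restrict_mono (fun z hz => ?_) le_rfl
  refine ⟨hz.2.1, lt_of_lt_of_le ?_ hbT⟩
  exact (ENNReal.ofReal_lt_ofReal_iff (hz.2.1.trans hz.2.2)).2 hz.2.2

theorem lintegral_eLpNorm_caloricExtension_le (hp0 : p ≠ 0) (hp : p ≠ ∞)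
    (f : 𝓢'(EuclideanSpace ℝ (Fin n), ℂ)) (hbT : ENNReal.ofReal b ≤ T) :
    ∫⁻ t in Set.Ioo 0 b, eLpNorm (fun x => caloricExtension f (x, t)) p volume ^ p.toReal ≤
      eLpNorm (caloricExtension f) p (volume.restrict (heatStrip n T)) ^ p.toReal := by
  have hr0 : 0 < p.toReal := ENNReal.toReal_pos hp0 hp
  have hpow : ∀ {X : Type} [MeasurableSpace X] (ρ : Measure X) (w : X → ℂ),
      eLpNorm w p ρ ^ p.toReal = ∫⁻ x, ‖w x‖ₑ ^ p.toReal ∂ρ := fun ρ w => by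
    rw [eLpNorm_eq_lintegral_rpow_enorm_toReal hp0 hp, ← ENNReal.rpow_mul,
      one_div_mul_cancel hr0.ne', ENNReal.rpow_one]
  have hle := prod_restrict_Ioo_le_restrict_heatStrip (n := n) hbT
  have hm : AEStronglyMeasurable (caloricExtension f)
      ((volume : Measure (EuclideanSpace ℝ (Fin n))).prod (volume.restrict (Set.Ioo 0 b))) :=
    (aestronglyMeasurable_caloricExtension f).mono_measure
      (hle.trans (Measure.restrict_mono (fun z hz => hz.1) le_rfl))
  simp_rw [hpow]
  rw [← lintegral_prod_symm _ (hm.enorm.pow_const p.toReal)]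
  exact lintegral_mono' hle le_rfl

/-- Fubini controls only almost every slice; a good time `s` in `(0,t)` exists, and monotonicity
carries its bound to `t`. -/
theorem eLpNorm_top_caloricExtension_slice_le (f : 𝓢'(EuclideanSpace ℝ (Fin n), ℂ))
    (hbT : ENNReal.ofReal b ≤ T) {t : ℝ} (ht : 0 < t) (htb : t ≤ b) :
    eLpNorm (fun x => caloricExtension f (x, t)) ∞ volume ≤
      eLpNorm (caloricExtension f) ∞ (volume.restrict (heatStrip n T)) := by
  have hae : ∀ᵐ z ∂((volume : Measure (EuclideanSpace ℝ (Fin n))).prod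
      (volume.restrict (Set.Ioo 0 t))), ‖caloricExtension f z‖ₑ ≤
        eLpNorm (caloricExtension f) ∞ (volume.restrict (heatStrip n T)) :=
    ae_mono (prod_restrict_Ioo_le_restrict_heatStrip ((ENNReal.ofReal_le_ofReal htb).trans hbT))
      (enorm_ae_le_eLpNormEssSup _ _)
  have hae' := Measure.ae_ae_of_ae_prod
    ((Measure.measurePreserving_swap (μ := volume.restrict (Set.Ioo 0 t))).quasiMeasurePreserving.ae
      hae)
  have hne : (volume.restrict (Set.Ioo 0 t)) ≠ 0 := by
    rw [Ne, Measure.restrict_eq_zero, Real.volume_Ioo, sub_zero, ENNReal.ofReal_eq_zero, not_le]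
    exact ht
  have : (ae (volume.restrict (Set.Ioo 0 t))).NeBot := ae_neBot.2 hne
  obtain ⟨s, hs, hs'⟩ := (hae'.and (ae_restrict_mem measurableSet_Ioo)).exists
  exact (eLpNorm_caloricExtension_antitone le_top f hs'.1 hs'.2.le).trans
    (eLpNormEssSup_le_of_ae_enorm_bound hs)

end Slices

/-! ### Comparing the dyadic sum with a time integral. -/

section Sum

variable {n : ℕ} {p T : ℝ≥0∞} {b : ℝ}

theorem ENNReal.rpow_le_mul_of_mul_le {c S K A : ℝ≥0∞} {r : ℝ} (hr : 0 < r) (hc : c ≠ 0)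
    (hc' : c ≠ ∞) (h : c * S ≤ K ^ r * A ^ r) : S ^ (1 / r) ≤ c⁻¹ ^ (1 / r) * K * A := by
  have h1 : S ≤ c⁻¹ * (K * A) ^ r := by
    rw [ENNReal.mul_rpow_of_nonneg _ _ hr.le]
    calc S = c⁻¹ * (c * S) := by rw [← mul_assoc, ENNReal.inv_mul_cancel hc hc', one_mul]
      _ ≤ _ := by gcongr
  refine (ENNReal.rpow_le_rpow h1 (by positivity)).trans (le_of_eq ?_)
  rw [ENNReal.mul_rpow_of_nonneg _ _ (by positivity), ← ENNReal.rpow_mul, mul_one_div_cancel hr.ne',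
    ENNReal.rpow_one, mul_assoc]

/-- Consecutive sample times have ratio `1/4`, so each gap is `3/4` of its right endpoint
`4^{-(i+1)} b`, while the weight to the power `p` is `4^{-(i+1)}`. -/
theorem mul_dyadic_weight_rpow (hp0 : p ≠ 0) (hp : p ≠ ∞) (hb : 0 < b) (i : ℕ) :
    ENNReal.ofReal (3 / 4 * b) * ((2 : ℝ≥0∞) ^ (-2 * (p⁻¹).toReal * ((i : ℝ) + 1))) ^ p.toReal =
      volume (Set.Ioo (((2 : ℝ) ^ (-(((i + 1 : ℕ) : ℤ) + 1))) ^ 2 * b)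
        (((2 : ℝ) ^ (-((i : ℤ) + 1))) ^ 2 * b)) := by
  have hr0 : 0 < p.toReal := ENNReal.toReal_pos hp0 hp
  have h1 : ((2 : ℝ≥0∞) ^ (-2 * (p⁻¹).toReal * ((i : ℝ) + 1))) ^ p.toReal =
      ENNReal.ofReal (((2 : ℝ) ^ (-((i : ℤ) + 1))) ^ 2) := by
    rw [← ENNReal.rpow_mul, ENNReal.toReal_inv,
      show -2 * p.toReal⁻¹ * ((i : ℝ) + 1) * p.toReal = -((i : ℝ) + 1) * 2 by field_simp,
      ← ENNReal.ofReal_ofNat, ENNReal.ofReal_rpow_of_pos two_pos, Real.rpow_mul two_pos.le,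
      ← Real.rpow_intCast]
    push_cast
    norm_num
  have h2 : (2 : ℝ) ^ (-(((i + 1 : ℕ) : ℤ) + 1)) = 2 ^ (-((i : ℤ) + 1)) / 2 := by
    rw [div_eq_mul_inv, ← zpow_sub_one₀ (two_ne_zero' ℝ)]
    congr 1
  rw [h1, Real.volume_Ioo, ← ENNReal.ofReal_mul (by positivity), h2]
  congr 1
  ring

theorem tsum_dyadic_le (hp0 : p ≠ 0) (hp : p ≠ ∞) (hb : 0 < b) {N : ℝ → ℝ≥0∞}
    (hN : ∀ s t, 0 < s → s ≤ t → N t ≤ N s) (B : ℕ → ℝ≥0∞) (K : ℝ≥0∞)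
    (hB : ∀ i : ℕ, B i ≤ K * N (((2 : ℝ) ^ (-((i : ℤ) + 1))) ^ 2 * b)) :
    ENNReal.ofReal (3 / 4 * b) *
        ∑' i : ℕ, ((2 : ℝ≥0∞) ^ (-2 * (p⁻¹).toReal * ((i : ℝ) + 1)) * B i) ^ p.toReal ≤
      K ^ p.toReal * ∫⁻ t in Set.Ioo 0 b, N t ^ p.toReal := by
  set τ : ℕ → ℝ := fun i => ((2 : ℝ) ^ (-((i : ℤ) + 1))) ^ 2 * b with hτ
  have hτ0 : ∀ i, 0 < τ i := fun i => by positivity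
  have hτa : Antitone τ := fun i j hij => by
    simp only [hτ]
    gcongr
    norm_num
  have hτb : ∀ i, τ i ≤ b := fun i => by
    have : (2 : ℝ) ^ (-((i : ℤ) + 1)) ≤ 1 := zpow_le_one_of_nonpos₀ one_le_two (by omega)
    have h' : ((2 : ℝ) ^ (-((i : ℤ) + 1))) ^ 2 ≤ 1 := pow_le_one₀ (by positivity) this
    simpa [hτ] using mul_le_mul_of_nonneg_right h' hb.le
  have hr0 : 0 < p.toReal := ENNReal.toReal_pos hp0 hp
  have hterm : ∀ i : ℕ, ENNReal.ofReal (3 / 4 * b) *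
      ((2 : ℝ≥0∞) ^ (-2 * (p⁻¹).toReal * ((i : ℝ) + 1)) * B i) ^ p.toReal ≤
        K ^ p.toReal * ∫⁻ t in Set.Ioo (τ (i + 1)) (τ i), N t ^ p.toReal := fun i => by
    rw [ENNReal.mul_rpow_of_nonneg _ _ hr0.le, ← mul_assoc, mul_dyadic_weight_rpow hp0 hp hb]
    calc volume (Set.Ioo (τ (i + 1)) (τ i)) * B i ^ p.toReal
        ≤ volume (Set.Ioo (τ (i + 1)) (τ i)) * (K ^ p.toReal * N (τ i) ^ p.toReal) := by
          rw [← ENNReal.mul_rpow_of_nonneg _ _ hr0.le]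
          gcongr
          exact hB i
      _ = K ^ p.toReal * ∫⁻ _ in Set.Ioo (τ (i + 1)) (τ i), N (τ i) ^ p.toReal := by
          rw [setLIntegral_const]
          ring
      _ ≤ _ := by
          refine mul_le_mul_right ?_ _
          refine setLIntegral_mono' measurableSet_Ioo fun t ht => ?_
          gcongr
          exact hN t _ ((hτ0 _).trans ht.1) ht.2.le
  rw [← ENNReal.tsum_mul_left]
  refine (ENNReal.tsum_le_tsum hterm).trans ?_
  rw [ENNReal.tsum_mul_left, ← lintegral_iUnion (s := fun i => Set.Ioo (τ (i + 1)) (τ i))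
    (fun i => measurableSet_Ioo) hτa.pairwise_disjoint_on_Ioo_succ]
  refine mul_le_mul_right ?_ _
  exact lintegral_mono_set (Set.iUnion_subset fun i =>
    Set.Ioo_subset_Ioo (hτ0 _).le (hτb i))

end Sum

/-! ### The main estimate. -/

theorem theorem5p4 (n : ℕ) (hn : 1 ≤ n) (p : ℝ≥0∞) (hp : 1 ≤ p) (T : ℝ≥0∞) (hT : 0 < T)
    (φ ψ : 𝓢(EuclideanSpace ℝ (Fin n), ℂ)) (hφψ : IsDyadicResolution φ ψ) :
    ∃ C : ℝ≥0, ∀ f : 𝓢'(EuclideanSpace ℝ (Fin n), ℂ),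
      MemBesov φ ψ (-2 * (p⁻¹).toReal) p p f →
        besovNorm φ ψ (-2 * (p⁻¹).toReal) p p f ≤
          C * eLpNorm (caloricExtension f) p (volume.restrict (heatStrip n T)) := by
  obtain ⟨b, hb, hbT⟩ : ∃ b : ℝ, 0 < b ∧ ENNReal.ofReal b ≤ T := by
    rcases eq_or_ne T ∞ with rfl | hT'
    · exact ⟨1, one_pos, le_top⟩
    · exact ⟨T.toReal, ENNReal.toReal_pos hT.ne' hT', ENNReal.ofReal_toReal_le⟩
  obtain ⟨K, hK⟩ := exists_eLpNorm_dyadicBlock_le hp hφψ.hasCompactSupport_fourier hb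
  obtain ⟨K', hK'⟩ := exists_eLpNorm_dyadicBlock_le hp hφψ.hasCompactSupport_fourier_low hb
  have hψ : ∀ f : 𝓢'(EuclideanSpace ℝ (Fin n), ℂ), eLpNorm (distribConv ψ f) p volume ≤
      K' * eLpNorm (fun x => caloricExtension f (x, b)) p volume := fun f => by
    -- `ψ` is its own block at level `0`, sampled at time `b`.
    simpa [dyadicBlock_zero] using hK' f 0
  rcases eq_or_ne p ∞ with rfl | hp'
  · refine ⟨max K' K, fun f _ => ?_⟩
    rw [besovNorm, if_pos rfl]
    refine max_le ?_ (iSup_le fun i => ?_)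
    · refine (hψ f).trans ?_
      gcongr
      · exact le_max_left _ _
      · exact eLpNorm_top_caloricExtension_slice_le f hbT hb le_rfl
    · have h1 : ((2 : ℝ) ^ (-((i : ℤ) + 1))) ^ 2 ≤ 1 :=
        pow_le_one₀ (by positivity) (zpow_le_one_of_nonpos₀ one_le_two (by omega))
      simp only [ENNReal.inv_top, ENNReal.toReal_zero, mul_zero, zero_mul, ENNReal.rpow_zero,
        one_mul]
      refine (hK f _).trans ?_
      gcongr
      · exact le_max_right _ _
      · exact eLpNorm_top_caloricExtension_slice_le f hbT (by positivity)
          (mul_le_of_le_one_left hb.le h1)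
  · have hp0 : p ≠ 0 := (zero_lt_one.trans_le hp).ne'
    have hr0 : 0 < p.toReal := ENNReal.toReal_pos hp0 hp'
    set c := ENNReal.ofReal (3 / 4 * b) with hc
    have hc0 : c ≠ 0 := by
      rw [hc, Ne, ENNReal.ofReal_eq_zero, not_le]
      positivity
    have hD : c⁻¹ ^ (1 / p.toReal) ≠ ∞ :=
      ENNReal.rpow_ne_top_of_nonneg (by positivity) (ENNReal.inv_ne_top.2 hc0)
    refine ⟨(c⁻¹ ^ (1 / p.toReal)).toNNReal * K' + (c⁻¹ ^ (1 / p.toReal)).toNNReal * K,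
      fun f _ => ?_⟩
    have hint := lintegral_eLpNorm_caloricExtension_le hp0 hp' f hbT
    have hN := fun s t (hs : 0 < s) (hst : s ≤ t) =>
      eLpNorm_caloricExtension_antitone hp f hs hst
    rw [besovNorm, if_neg hp']
    push_cast
    rw [ENNReal.coe_toNNReal hD, add_mul]
    refine add_le_add ?_ (ENNReal.rpow_le_mul_of_mul_le hr0 hc0 ENNReal.ofReal_ne_top
      ((tsum_dyadic_le hp0 hp' hb hN _ K fun i => hK f _).trans (by gcongr)))
    -- The low-frequency piece is compared with all of `(0,b)`, whose length exceeds `3/4 * b`, so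
    -- the same `c` serves both pieces.
    have h1 : c * eLpNorm (distribConv ψ f) p volume ^ p.toReal ≤ (K' : ℝ≥0∞) ^ p.toReal *
        eLpNorm (caloricExtension f) p (volume.restrict (heatStrip n T)) ^ p.toReal := by
      refine le_trans ?_ (mul_le_mul_right hint _)
      calc c * eLpNorm (distribConv ψ f) p volume ^ p.toReal
          ≤ volume (Set.Ioo 0 b) * (K' *
              eLpNorm (fun x => caloricExtension f (x, b)) p volume) ^ p.toReal := by
            rw [Real.volume_Ioo, sub_zero, hc]
            gcongr
            · linarith
            · exact hψ f
        _ = (K' : ℝ≥0∞) ^ p.toReal * ∫⁻ _ in Set.Ioo 0 b,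
              eLpNorm (fun x => caloricExtension f (x, b)) p volume ^ p.toReal := by
            rw [setLIntegral_const, ENNReal.mul_rpow_of_nonneg _ _ hr0.le]
            ring
        _ ≤ _ := by
            refine mul_le_mul_right ?_ _
            refine setLIntegral_mono' measurableSet_Ioo fun t ht => ?_
            gcongr
            exact hN t b ht.1 ht.2.le
    have h2 := ENNReal.rpow_le_mul_of_mul_le hr0 hc0 ENNReal.ofReal_ne_top h1
    rwa [← ENNReal.rpow_mul, mul_one_div_cancel hr0.ne', ENNReal.rpow_one] at h2
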